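/- Consider the i.i.d. binary deletion/substitution channel: each transmitted bit is, independently of the others, deleted with probability $p_d$, flipped with probability $p_s$, and correctly transmitted with probability $1-p_d-p_s$; the receiver sees only the sequence of the remaining (possibly flipped) bits. A rate $R$ is achievable if for every $\delta>0$ and all sufficiently large $n$ there are a codebook $\mathcal C\subseteq\{0,1\}^n$ with $|\mathcal C|\ge 2^{nR}$ and a decoder that recovers a uniformly chosen codeword of $\mathcal C$ from the channel output with probability at least $1-\delta$. Let the capacity $C=C(p_d,p_s)$ be the supremum of the achievable rates, $H(p)=-p\log_2 p-(1-p)\log_2(1-p)$ the binary entropy function, and $p_s'=p_s/(1-p_d)$. Theorem. There is a function $o(p_d,p_s)$ with $o(p_d,p_s)\to 0$ as $(p_d,p_s)\to(0,0)$ such that, for all $p_d,p_s\ge 0$ with $p_d<1$ and $p_d+p_s\le 1$, $$C(p_d,p_s)\le 1-\bigl(1-o(p_d,p_s)\bigr)\bigl(H(p_d)+H(p_s')\bigr).$$ -/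

import Mathlib

open Filter Topology

/-- What the channel does to a single transmitted bit. -/
inductive BitAction where
  | keep
  | flip
  | delete
  deriving DecidableEq

instance : Fintype BitAction where
  elems := {.keep, .flip, .delete}
  complete := by intro b; cases b <;> simp

/-- The probability of each action: deletion `pd`, substitution `ps`,
correct transmission `1 - pd - ps`. -/
noncomputable def BitAction.prob (pd ps : ℝ) : BitAction → ℝ
  | .keep => 1 - pd - ps
  | .flip => ps
  | .delete => pd

/-- The effect of an action on a bit; `none` means that the bit is deleted. -/
def BitAction.apply : BitAction → Bool → Option Bool
  | .keep, b => some b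
  | .flip, b => some (!b)
  | .delete, _ => none

/-- The received string when `x` is sent and the channel acts on the `i`-th bit by `a i`:
the surviving bits, possibly flipped, in their original order. The positions of the
deleted bits are not visible to the receiver. -/
def received {n : ℕ} (x : Fin n → Bool) (a : Fin n → BitAction) : List Bool :=
  (List.ofFn fun i => (a i).apply (x i)).reduceOption

/-- The probability that the channel acts by the pattern `a`; the bits are affected
independently of each other. -/
noncomputable def patternProb (pd ps : ℝ) {n : ℕ} (a : Fin n → BitAction) : ℝ :=
  ∏ i, (a i).prob pd ps

/-- The probability that the decoder `g` recovers `x` from the channel output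
when `x` is sent. -/
noncomputable def correctProb (pd ps : ℝ) {n : ℕ} (g : List Bool → (Fin n → Bool))
    (x : Fin n → Bool) : ℝ :=
  ∑ a : Fin n → BitAction, if g (received x a) = x then patternProb pd ps a else 0

/-- The success probability of the decoder `g` on the codebook `C`, for a codeword
chosen uniformly from `C`. -/
noncomputable def successProb (pd ps : ℝ) {n : ℕ} (C : Finset (Fin n → Bool))
    (g : List Bool → (Fin n → Bool)) : ℝ :=
  (∑ x ∈ C, correctProb pd ps g x) / (C.card : ℝ)

/-- `R` (in bits per transmitted bit) is an achievable rate: for every `δ > 0` and all large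
block lengths `n` there are a codebook of at least `2 ^ (n R)` binary words of length `n` and
a decoder that succeeds with probability at least `1 - δ`. -/
def AchievableRate (pd ps R : ℝ) : Prop :=
  ∀ δ : ℝ, 0 < δ → ∀ᶠ n : ℕ in atTop,
    ∃ (C : Finset (Fin n → Bool)) (g : List Bool → (Fin n → Bool)),
      C.Nonempty ∧ (2 : ℝ) ^ ((n : ℝ) * R) ≤ (C.card : ℝ) ∧ 1 - δ ≤ successProb pd ps C g

/-- The capacity of the i.i.d. deletion/substitution channel: the supremum of the
achievable rates. -/
noncomputable def delSubCapacity (pd ps : ℝ) : ℝ :=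
  sSup {R : ℝ | AchievableRate pd ps R}

/-- The binary entropy function, in bits. -/
noncomputable def entropyBits (p : ℝ) : ℝ :=
  Real.binEntropy p / Real.log 2

/-- The pattern probabilities sum to one. -/
theorem sum_patternProb (pd ps : ℝ) (n : ℕ) :
    ∑ a : Fin n → BitAction, patternProb pd ps a = 1 := by
  have h : ∑ b : BitAction, b.prob pd ps = 1 := by
    have : (Finset.univ : Finset BitAction) = {.keep, .flip, .delete} := by decide
    rw [this]
    simp [BitAction.prob]
    ring
  have h2 := Fintype.sum_pow (fun b : BitAction => b.prob pd ps) n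
  rw [h, one_pow] at h2
  exact h2.symm

/-- The supremum that defines the capacity is over a nonempty set. -/
theorem achievableRate_zero (pd ps : ℝ) : AchievableRate pd ps 0 := by
  intro δ hδ
  refine Eventually.of_forall fun n => ⟨{fun _ => false}, fun _ _ => false, by simp, by simp, ?_⟩
  simp [successProb, correctProb, sum_patternProb, hδ.le]

/-- The supremum that defines the capacity is over a set that is bounded above. -/
theorem AchievableRate.le_one {pd ps R : ℝ} (h : AchievableRate pd ps R) : R ≤ 1 := by
  obtain ⟨n, ⟨C, g, -, hC, -⟩, hn⟩ := ((h 1 one_pos).and (eventually_ge_atTop 1)).exists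
  have h1 : (C.card : ℝ) ≤ (2 : ℝ) ^ (n : ℝ) := by
    have : C.card ≤ 2 ^ n := by simpa using Finset.card_le_univ C
    rw [Real.rpow_natCast]
    exact_mod_cast this
  have h2 := (Real.rpow_le_rpow_left_iff (x := 2) one_lt_two).1 (hC.trans h1)
  have h3 : (0 : ℝ) < n := by exact_mod_cast hn
  nlinarith

/-! A decoder that finds the codeword `x` from the output `y` leaves only one thing unknown: the
action pattern `a`, given `x` and `y`. There are about `2^n` outputs, so `log |C|` plus the entropy
of the pattern is at most `n log 2` plus the mean cost of describing `a` to someone who knows `x`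
and `y`, up to small terms (`successProb_mul_log_card_le`). By `actionEntropy_eq` the pattern has
entropy `h(pd) + (1 - pd) h(ps')` per letter, with `h` the entropy in nats. It remains to describe
`a` at a cost per letter that is a small fraction of `h(pd) + h(ps')`.

A description is a weight of total mass at most one, and its cost is minus the logarithm. Cut the
word into blocks of length `B` of order `η / (pd + ps)`. In a block without deletions the flips can
be read off. A single deletion without flips need only be located within its run. Any other block
lists its deletions at `log B` each; every such deletion is accompanied by a second error in its
block, which has probability at most about `η`, so this costs at most `η h(pd)` per letter
(`sum_blockCost_le`).

Locating a deletion in a long run could still cost as much as `h(pd)`. But the rate may be assumed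
to exceed `1 - H(pd) - H(ps')`, as otherwise nothing is to be proved, and a code of rate near one
has few long runs (`sum_constInd_le`). All other terms are linear in `pd` and `ps`, hence negligible
against `-p log p`. -/

/-! ### Expectations under product measures -/

theorem sum_prod_mul_prod {ι α : Type*} [Fintype ι] [DecidableEq ι] [Fintype α]
    (μ : α → ℝ) (φ : ι → α → ℝ) :
    ∑ a : ι → α, (∏ i, μ (a i)) * ∏ i, φ i (a i) = ∏ i, ∑ b, μ b * φ i b := by
  rw [Fintype.prod_sum]
  simp [Finset.prod_mul_distrib]

theorem sum_prod_mul_apply {ι α : Type*} [Fintype ι] [DecidableEq ι] [Fintype α]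
    {μ : α → ℝ} (hμ : ∑ b, μ b = 1) (f : α → ℝ) (i : ι) :
    ∑ a : ι → α, (∏ i, μ (a i)) * f (a i) = ∑ b, μ b * f b := by
  have h := sum_prod_mul_prod μ (fun j b => if j = i then f b else 1 : ι → α → ℝ)
  rw [Finset.prod_eq_single i (by intro j _ hj; simp [hj, hμ]) (by simp)] at h
  simp only [Finset.prod_ite_eq', Finset.mem_univ, if_true] at h
  exact h

theorem sum_prod_mul_apply_mul_apply {ι α : Type*} [Fintype ι] [DecidableEq ι] [Fintype α]
    {μ : α → ℝ} (hμ : ∑ b, μ b = 1) (f g : α → ℝ) {i j : ι} (hij : i ≠ j) :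
    ∑ a : ι → α, (∏ i, μ (a i)) * (f (a i) * g (a j)) =
      (∑ b, μ b * f b) * ∑ b, μ b * g b := by
  have h := sum_prod_mul_prod μ
    (fun k b => (if k = i then f b else 1) * (if k = j then g b else 1) : ι → α → ℝ)
  have h2 : ∏ k, ∑ b, μ b * ((if k = i then f b else 1) * (if k = j then g b else 1)) =
      ∏ k, ((if k = i then ∑ b, μ b * f b else 1) * (if k = j then ∑ b, μ b * g b else 1)) := by
    refine Finset.prod_congr rfl fun k _ => ?_
    by_cases h1 : k = i
    · subst h1; simp [hij]
    · by_cases h2 : k = j <;> simp [h1, h2, hμ, hij.symm]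
  rw [h2] at h
  simp only [Finset.prod_mul_distrib, Finset.prod_ite_eq', Finset.mem_univ, if_true] at h
  exact h

theorem BitAction.sum_eq {M : Type*} [AddCommMonoid M] (f : BitAction → M) :
    ∑ b, f b = f .keep + f .flip + f .delete := by
  have : (Finset.univ : Finset BitAction) = {.keep, .flip, .delete} := by decide
  rw [this]
  simp [add_assoc]

theorem BitAction.sum_prob (pd ps : ℝ) : ∑ b : BitAction, b.prob pd ps = 1 := by
  rw [BitAction.sum_eq]
  simp only [BitAction.prob]
  ring

theorem BitAction.prob_nonneg {pd ps : ℝ} (hd : 0 ≤ pd) (hs : 0 ≤ ps) (h : pd + ps ≤ 1)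
    (b : BitAction) : 0 ≤ b.prob pd ps := by
  cases b <;> simp only [BitAction.prob] <;> linarith

theorem patternProb_nonneg {pd ps : ℝ} (hd : 0 ≤ pd) (hs : 0 ≤ ps) (h : pd + ps ≤ 1) {n : ℕ}
    (a : Fin n → BitAction) : 0 ≤ patternProb pd ps a :=
  Finset.prod_nonneg fun _ _ => BitAction.prob_nonneg hd hs h _

/-! ### Counting outputs, and the weak converse -/

theorem length_received_le {n : ℕ} (x : Fin n → Bool) (a : Fin n → BitAction) :
    (received x a).length ≤ n := by
  simpa [received] using List.reduceOption_length_le (List.ofFn fun i => (a i).apply (x i))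

/-- All binary strings of length at most `n`. -/
def shortStrings (n : ℕ) : Finset (List Bool) :=
  (Finset.range (n + 1)).biUnion fun k => Finset.univ.image fun v : Fin k → Bool => List.ofFn v

theorem mem_shortStrings {n : ℕ} {y : List Bool} (h : y.length ≤ n) : y ∈ shortStrings n := by
  simp only [shortStrings, Finset.mem_biUnion, Finset.mem_range, Finset.mem_image,
    Finset.mem_univ, true_and]
  exact ⟨y.length, by omega, y.get, List.ofFn_get y⟩

theorem card_shortStrings_le (n : ℕ) : (shortStrings n).card ≤ 2 ^ (n + 1) := by
  refine Finset.card_biUnion_le.trans ?_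
  calc _ ≤ ∑ k ∈ Finset.range (n + 1), 2 ^ k :=
        Finset.sum_le_sum fun k _ => Finset.card_image_le.trans (by simp)
    _ ≤ 2 ^ (n + 1) := by
        have := Nat.geomSum_eq (le_refl 2) (n + 1)
        rw [this]; simp

theorem sub_le_mul_log_sub_log {p v : ℝ} (hp : 0 ≤ p) (hv : 0 < v) :
    p - v ≤ p * (Real.log p - Real.log v) := by
  rcases hp.eq_or_lt with rfl | hp
  · simp [hv.le]
  · have h := Real.one_sub_inv_le_log_of_pos (div_pos hp hv)
    rw [Real.log_div hp.ne' hv.ne', inv_div] at h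
    have := mul_le_mul_of_nonneg_left h hp.le
    have e : p * (1 - v / p) = p - v := by field_simp
    linarith

/-- The entropy, in nats, of the action on a single bit. -/
noncomputable def actionEntropy (pd ps : ℝ) : ℝ :=
  -∑ b : BitAction, b.prob pd ps * Real.log (b.prob pd ps)

/-- `∑ log` of the action probabilities. -/
noncomputable def logPattern (pd ps : ℝ) {n : ℕ} (a : Fin n → BitAction) : ℝ :=
  ∑ i, Real.log ((a i).prob pd ps)

/-- If an action of the pattern has probability zero, the logarithm of the product may differ from
the sum of the logarithms, but then the factor in front vanishes. -/
theorem patternProb_mul_log (pd ps : ℝ) {n : ℕ} (a : Fin n → BitAction) :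
    patternProb pd ps a * Real.log (patternProb pd ps a) =
      patternProb pd ps a * logPattern pd ps a := by
  by_cases h : patternProb pd ps a = 0
  · simp [h]
  · rw [logPattern, ← Real.log_prod, patternProb]
    intro i _
    exact (Finset.prod_ne_zero_iff.1 h) i (Finset.mem_univ i)

theorem sum_patternProb_mul_logPattern (pd ps : ℝ) (n : ℕ) :
    ∑ a : Fin n → BitAction, patternProb pd ps a * logPattern pd ps a =
      -(n * actionEntropy pd ps) := by
  simp only [logPattern, Finset.mul_sum]
  rw [Finset.sum_comm]
  have h : ∀ i : Fin n, ∑ a : Fin n → BitAction,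
      patternProb pd ps a * Real.log ((a i).prob pd ps) = -actionEntropy pd ps := by
    intro i
    rw [actionEntropy, neg_neg]
    exact sum_prod_mul_apply (BitAction.sum_prob pd ps)
      (fun b => Real.log (b.prob pd ps)) i
  simp [h]

/-- A weight on the action patterns such that, given the sent and the received word, the total
weight of the possible patterns is at most one. -/
structure IsPatternKernel {n : ℕ} (w : (Fin n → Bool) → (Fin n → BitAction) → ℝ) : Prop where
  pos : ∀ x a, 0 < w x a
  sum_le : ∀ x y, ∑ a, (if received x a = y then w x a else 0) ≤ 1

theorem IsPatternKernel.le_one {n : ℕ} {w : (Fin n → Bool) → (Fin n → BitAction) → ℝ}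
    (hw : IsPatternKernel w) (x : Fin n → Bool) (a : Fin n → BitAction) : w x a ≤ 1 := by
  refine le_trans ?_ (hw.sum_le x (received x a))
  have := Finset.single_le_sum (s := Finset.univ)
    (f := fun a' => if received x a' = received x a then w x a' else 0)
    (fun a' _ => by split_ifs; exacts [(hw.pos x a').le, le_rfl]) (Finset.mem_univ a)
  simpa using this

/-- Each output `y` decodes to the one word `g y` and so contributes at most one; then count the
outputs. -/
theorem IsPatternKernel.sum_decoded_le {n : ℕ} {w : (Fin n → Bool) → (Fin n → BitAction) → ℝ}
    (hw : IsPatternKernel w) (C : Finset (Fin n → Bool)) (g : List Bool → (Fin n → Bool)) :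
    ∑ x ∈ C, ∑ a, (if g (received x a) = x then w x a else 0) ≤ 2 ^ (n + 1) := by
  have h1 : ∀ x a, (if g (received x a) = x then w x a else 0) =
      ∑ y ∈ shortStrings n, if g y = x then (if received x a = y then w x a else 0) else 0 := by
    intro x a
    rw [Finset.sum_eq_single (received x a)]
    · simp
    · intro y _ hy
      simp [Ne.symm hy]
    · intro h
      exact absurd (mem_shortStrings (length_received_le x a)) h
  simp only [h1]
  have h2 : ∀ x : Fin n → Bool, ∑ a : Fin n → BitAction, ∑ y ∈ shortStrings n,
      (if g y = x then (if received x a = y then w x a else 0) else 0) =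
      ∑ y ∈ shortStrings n, if g y = x then ∑ a : Fin n → BitAction,
        (if received x a = y then w x a else 0) else 0 := by
    intro x
    rw [Finset.sum_comm]
    refine Finset.sum_congr rfl fun y _ => ?_
    split_ifs <;> simp
  simp only [h2]
  rw [Finset.sum_comm]
  calc _ ≤ ∑ y ∈ shortStrings n, (1 : ℝ) := by
        refine Finset.sum_le_sum fun y _ => ?_
        rw [Finset.sum_ite_eq]
        split_ifs
        exacts [hw.sum_le _ _, zero_le_one]
    _ ≤ 2 ^ (n + 1) := by
        simp only [Finset.sum_const, nsmul_eq_mul, mul_one]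
        exact_mod_cast card_shortStrings_le n

/-- The weak converse: the number of messages is limited by the entropy of the channel action,
up to the cost of describing the action to someone who knows the sent and the received word. -/
theorem successProb_mul_log_card_le {pd ps : ℝ} (hd : 0 ≤ pd) (hs : 0 ≤ ps) (h : pd + ps ≤ 1)
    {n : ℕ} {w : (Fin n → Bool) → (Fin n → BitAction) → ℝ} (hw : IsPatternKernel w)
    {C : Finset (Fin n → Bool)} (hC : C.Nonempty) (g : List Bool → (Fin n → Bool))
    {M : ℝ} (hM : ∀ b : BitAction, -Real.log (b.prob pd ps) ≤ M) :
    successProb pd ps C g * Real.log C.card ≤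
      1 + (n + 1) * Real.log 2 - n * actionEntropy pd ps +
        (1 - successProb pd ps C g) * (n * M) +
        (∑ x ∈ C, ∑ a, patternProb pd ps a * -Real.log (w x a)) / C.card := by
  have hc : (0 : ℝ) < C.card := by exact_mod_cast hC.card_pos
  set c : ℝ := (C.card : ℝ) with hcdef
  have hL : ∀ a : Fin n → BitAction, -logPattern pd ps a ≤ n * M := by
    intro a
    rw [logPattern, ← Finset.sum_neg_distrib]
    refine (Finset.sum_le_sum fun i _ => hM (a i)).trans ?_
    simp
  have hP := patternProb_nonneg hd hs h (n := n)
  -- termwise Gibbs inequality, multiplied by `c`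
  have key : ∀ x a, patternProb pd ps a - c * (w x a / 2 ^ (n + 1)) ≤
      patternProb pd ps a *
        (logPattern pd ps a - Real.log c + -Real.log (w x a) + (n + 1) * Real.log 2) := by
    intro x a
    have hv : 0 < c * (w x a / 2 ^ (n + 1)) :=
      mul_pos hc (div_pos (hw.pos x a) (by positivity))
    have h1 := sub_le_mul_log_sub_log (hP a) hv
    rw [mul_sub, patternProb_mul_log, Real.log_mul hc.ne'
      (div_pos (hw.pos x a) (by positivity)).ne', Real.log_div (hw.pos x a).ne' (by positivity),
      Real.log_pow] at h1
    push_cast at h1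
    linarith
  -- For pairs that are not decoded the left side is zero, and the term with `n * M` makes up for
  -- the negative `logPattern`.
  have key2 : ∀ x a, (if g (received x a) = x then patternProb pd ps a else 0) -
        c / 2 ^ (n + 1) * (if g (received x a) = x then w x a else 0) ≤
      patternProb pd ps a * logPattern pd ps a
        + n * M * (patternProb pd ps a - if g (received x a) = x then patternProb pd ps a else 0)
        - Real.log c * (if g (received x a) = x then patternProb pd ps a else 0)
        + patternProb pd ps a * -Real.log (w x a)
        + (n + 1) * Real.log 2 * patternProb pd ps a := by
    intro x a
    split_ifs
    · have := key x a
      have e : c / 2 ^ (n + 1) * w x a = c * (w x a / 2 ^ (n + 1)) := by ring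
      rw [e]
      linarith
    · have h1 := mul_nonneg (hP a) (sub_nonneg.2 (hL a))
      have h2 : 0 ≤ patternProb pd ps a * -Real.log (w x a) :=
        mul_nonneg (hP a) (neg_nonneg.2 (Real.log_nonpos (hw.pos x a).le (hw.le_one x a)))
      have h3 : 0 ≤ (n + 1) * Real.log 2 * patternProb pd ps a :=
        mul_nonneg (mul_nonneg (by positivity) (Real.log_nonneg one_le_two)) (hP a)
      nlinarith
  have key3 := Finset.sum_le_sum fun x (_ : x ∈ C) =>
    Finset.sum_le_sum fun a (_ : a ∈ (Finset.univ : Finset (Fin n → BitAction))) => key2 x a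
  simp only [Finset.sum_sub_distrib, Finset.sum_add_distrib, ← Finset.mul_sum,
    sum_patternProb, sum_patternProb_mul_logPattern] at key3
  have hdec := hw.sum_decoded_le C g
  have hs' : ∑ x ∈ C, ∑ a : Fin n → BitAction,
      (if g (received x a) = x then patternProb pd ps a else 0) = successProb pd ps C g * c := by
    rw [successProb, div_mul_cancel₀ _ hc.ne']
    rfl
  simp only [hs', Finset.sum_const, nsmul_eq_mul, mul_one, ← hcdef] at key3
  have hdec' : c / 2 ^ (n + 1) *
      ∑ x ∈ C, ∑ a, (if g (received x a) = x then w x a else 0) ≤ c := by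
    calc _ ≤ c / 2 ^ (n + 1) * 2 ^ (n + 1) := mul_le_mul_of_nonneg_left hdec (by positivity)
      _ = c := by field_simp
  have hs0 : 0 ≤ successProb pd ps C g * c := by
    rw [← hs']
    exact Finset.sum_nonneg fun x _ => Finset.sum_nonneg fun a _ => by
      split_ifs; exacts [hP a, le_rfl]
  refine le_of_mul_le_mul_right ?_ hc
  rw [add_mul _ (_ / c), div_mul_cancel₀ _ hc.ne']
  simp only [Finset.mul_sum] at key3 hdec' ⊢
  nlinarith

/-! ### What the output reveals about the pattern -/

theorem received_succ {n : ℕ} (x : Fin (n + 1) → Bool) (a : Fin (n + 1) → BitAction) :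
    received x a =
      ((a 0).apply (x 0)).toList ++ received (fun i => x i.succ) (fun i => a i.succ) := by
  rw [received, List.ofFn_succ, received]
  cases (a 0).apply (x 0) <;> simp [List.reduceOption_cons_of_some, List.reduceOption_cons_of_none]

/-- The set of positions that a pattern deletes. -/
def deletions {n : ℕ} (a : Fin n → BitAction) : Finset (Fin n) :=
  Finset.univ.filter fun i => a i = .delete

/-- The sent word, the received word and the deleted positions determine the flips. -/
theorem eq_of_received_prefix : ∀ {n : ℕ} (x : Fin n → Bool) (a a' : Fin n → BitAction)
    (z : List Bool), (∀ i, a i = .delete ↔ a' i = .delete) →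
    received x a <+: z → received x a' <+: z → a = a'
  | 0, _, _, _, _, _, _, _ => Subsingleton.elim _ _
  | n + 1, x, a, a', z, hD, h, h' => by
    rw [received_succ] at h h'
    have h0 := hD 0
    -- Either both patterns delete the first bit, or both emit a letter; in the second case it is
    -- the head of `z`, which tells whether `x 0` was flipped.
    have key : ∃ z', a 0 = a' 0 ∧ received (fun i => x i.succ) (fun i => a i.succ) <+: z' ∧
        received (fun i => x i.succ) (fun i => a' i.succ) <+: z' := by
      cases z with
      | nil =>
        refine ⟨[], ?_⟩
        cases ha : a 0 <;> cases ha' : a' 0 <;> simp_all [BitAction.apply]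
      | cons b z =>
        cases ha : a 0 <;> cases ha' : a' 0 <;>
          simp_all [BitAction.apply, List.cons_prefix_cons]
        · exact ⟨z, h.2, h'⟩
        · exact ⟨z, h.2, h'⟩
        · exact ⟨_, h, h'⟩
    obtain ⟨z', h1, h2, h3⟩ := key
    have ih := eq_of_received_prefix _ _ _ z' (fun i => hD i.succ) h2 h3
    funext i
    refine Fin.cases h1 (fun i => congrFun ih i) i

theorem injOn_deletions {n : ℕ} (x : Fin n → Bool) (z : List Bool) :
    Set.InjOn deletions {a : Fin n → BitAction | received x a <+: z} := by
  intro a ha a' ha' h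
  refine eq_of_received_prefix x a a' z (fun i => ?_) ha ha'
  have := Finset.ext_iff.1 h i
  simpa [deletions] using this

/-- Once `x` and `z` are known, describing a compatible pattern amounts to describing its deletion
set. -/
theorem sum_prefix_deletions_le {n : ℕ} (x : Fin n → Bool) (z : List Bool)
    {f : Finset (Fin n) → ℝ} (hf : ∀ D, 0 ≤ f D) :
    ∑ a, (if received x a <+: z then f (deletions a) else 0) ≤ ∑ D, f D := by
  rw [← Finset.sum_filter, ← Finset.sum_image (f := f) (g := deletions)]
  · exact Finset.sum_le_sum_of_subset_of_nonneg (Finset.subset_univ _) fun D _ _ => hf D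
  · intro a ha a' ha'
    exact injOn_deletions x z (by simpa using ha) (by simpa using ha')

/-- The pattern that deletes the bit `i` and keeps all others. -/
def singleDeletion {n : ℕ} (i : Fin n) : Fin n → BitAction :=
  fun j => if j = i then .delete else .keep

theorem received_keep {n : ℕ} (x : Fin n → Bool) :
    received x (fun _ => .keep) = List.ofFn x := by
  induction n with
  | zero => simp [received]
  | succ n ih => rw [received_succ, ih]; simp [BitAction.apply, List.ofFn_succ]

theorem received_singleDeletion {n : ℕ} (x : Fin n → Bool) (i : Fin n) :
    received x (singleDeletion i) = (List.ofFn x).eraseIdx i := by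
  induction n with
  | zero => exact i.elim0
  | succ n ih =>
    rw [received_succ]
    refine Fin.cases ?_ (fun i => ?_) i
    · have : (fun j : Fin n => singleDeletion (0 : Fin (n + 1)) j.succ) = fun _ => .keep := by
        funext j; simp [singleDeletion]
      rw [this, received_keep]
      simp [singleDeletion, BitAction.apply, List.ofFn_succ]
    · have : (fun j : Fin n => singleDeletion i.succ j.succ) = singleDeletion i := by
        funext j; simp [singleDeletion]
      rw [this, ih]
      simp [singleDeletion, BitAction.apply, List.ofFn_succ, (Fin.succ_ne_zero i).symm]

theorem length_received_singleDeletion {n : ℕ} (x : Fin n → Bool) (i : Fin n) :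
    (received x (singleDeletion i)).length = n - 1 := by
  rw [received_singleDeletion, List.length_eraseIdx_of_lt (by simp)]
  simp

/-- Two single deletions with the same effect are in the same run. -/
theorem constant_of_received_singleDeletion {n : ℕ} {x : Fin n → Bool} {z : List Bool}
    {i j : Fin n} (hi : received x (singleDeletion i) <+: z)
    (hj : received x (singleDeletion j) <+: z) {k : Fin n} (hik : i ≤ k) (hkj : k ≤ j) :
    x k = x i := by
  have h : (List.ofFn x).eraseIdx i = (List.ofFn x).eraseIdx j := by
    rw [← received_singleDeletion, ← received_singleDeletion]
    refine (List.prefix_of_prefix_length_le hi hj ?_).eq_of_length ?_ <;>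
      simp [length_received_singleDeletion]
  have step : ∀ (k : ℕ) (h1 : i.1 ≤ k) (h2 : k ≤ j.1), x ⟨k, h2.trans_lt j.2⟩ = x i := by
    intro k h1
    induction k, h1 using Nat.le_induction with
    | base => intro _; rfl
    | succ k hk ih =>
      intro h2
      rw [← ih (by omega)]
      have hj' := j.2
      have e := congrArg (fun l => l[k]?) h
      simp only [List.getElem?_eraseIdx] at e
      rw [if_neg (by omega), if_pos (by omega), List.getElem?_ofFn, List.getElem?_ofFn,
        dif_pos (by omega), dif_pos (by omega)] at e
      exact Option.some_injective _ e
  exact step k.1 hik hkj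

/-! ### Kernels on blocks and their products -/

/-- Read `z` from the left: an action on the first block fixes what remains of `z`, and induction
applies to that. Prefixes replace equality because the output does not show where a block ends. -/
theorem sum_flatten_prefix_le {α : Type*} [Fintype α] : ∀ (m : ℕ) (r : Fin m → α → List Bool)
    (u : Fin m → α → ℝ), (∀ i a, 0 ≤ u i a) →
    (∀ i z, ∑ a, (if r i a <+: z then u i a else 0) ≤ 1) → ∀ z : List Bool,
    ∑ a : Fin m → α, (if (List.ofFn fun i => r i (a i)).flatten <+: z
      then ∏ i, u i (a i) else 0) ≤ 1
  | 0, _, _, _, _, _ => by simp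
  | m + 1, r, u, hu, h, z => by
    rw [← (Fin.consEquiv fun _ => α).sum_comp, Fintype.sum_prod_type]
    refine le_trans (Finset.sum_le_sum fun a _ => ?_) (h 0 z)
    simp only [Fin.consEquiv, Equiv.coe_fn_mk, List.ofFn_succ, Fin.cons_zero, Fin.cons_succ,
      List.flatten_cons, Fin.prod_univ_succ]
    by_cases hp : r 0 a <+: z
    · obtain ⟨z', rfl⟩ := hp
      simp only [List.prefix_append_right_inj, List.prefix_append, if_true]
      have ih := sum_flatten_prefix_le m (fun i => r i.succ) (fun i => u i.succ)
        (fun i => hu i.succ) (fun i => h i.succ) z'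
      have := mul_le_mul_of_nonneg_left ih (hu 0 a)
      simpa [Finset.mul_sum, mul_ite] using this
    · rw [if_neg hp]
      refine (Finset.sum_eq_zero fun b _ => if_neg fun hb => hp ?_).le
      exact (List.prefix_append _ _).trans hb

/-- The `i`-th block of a word of `m` blocks. -/
def block {m B : ℕ} {α : Type*} (x : Fin (m * B) → α) (i : Fin m) : Fin B → α :=
  fun j => x (finProdFinEquiv (i, j))

/-- Cutting a word into blocks. -/
def blockEquiv (m B : ℕ) (α : Type*) : (Fin (m * B) → α) ≃ (Fin m → Fin B → α) :=
  (finProdFinEquiv.symm.arrowCongr (Equiv.refl α)).trans (Equiv.curry (Fin m) (Fin B) α)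

theorem blockEquiv_apply {m B : ℕ} {α : Type*} (x : Fin (m * B) → α) :
    blockEquiv m B α x = block x := rfl

theorem received_eq_flatten {m B : ℕ} (x : Fin (m * B) → Bool) (a : Fin (m * B) → BitAction) :
    received x a = (List.ofFn fun i => received (block x i) (block a i)).flatten := by
  rw [received, List.ofFn_mul, List.reduceOption, List.filterMap_flatten, List.map_ofFn]
  congr 2
  funext i
  simp only [Function.comp, received, List.reduceOption, block]
  congr 2
  funext j
  have : (finProdFinEquiv (i, j)) = (⟨i * B + j, by
      calc (i : ℕ) * B + j < (i + 1) * B := by rw [add_mul, one_mul]; omega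
        _ ≤ m * B := Nat.mul_le_mul_right _ i.2⟩ : Fin (m * B)) := by
    ext; simp [finProdFinEquiv, mul_comm, add_comm]
  rw [this]

theorem prod_block {m B : ℕ} {α : Type*} (x : Fin (m * B) → α) (f : α → ℝ) :
    ∏ i, f (x i) = ∏ i, ∏ j, f (block x i j) := by
  rw [← finProdFinEquiv.prod_comp, Fintype.prod_prod_type]
  rfl

/-- A weight on the action patterns of a block such that the total weight of the patterns whose
output is a prefix of a given string is at most one. -/
structure IsBlockKernel {B : ℕ} (u : (Fin B → Bool) → (Fin B → BitAction) → ℝ) : Prop where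
  pos : ∀ x a, 0 < u x a
  sum_le : ∀ x z, ∑ a, (if received x a <+: z then u x a else 0) ≤ 1

theorem IsBlockKernel.isPatternKernel {B : ℕ} {u : (Fin B → Bool) → (Fin B → BitAction) → ℝ}
    (hu : IsBlockKernel u) (m : ℕ) : IsPatternKernel fun (x : Fin (m * B) → Bool) a =>
      ∏ i, u (block x i) (block a i) where
  pos x a := Finset.prod_pos fun i _ => hu.pos _ _
  sum_le x y := by
    have h := sum_flatten_prefix_le m (fun i a => received (block x i) a)
      (fun i a => u (block x i) a) (fun i a => (hu.pos _ _).le) (fun i z => hu.sum_le _ z) y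
    rw [← (blockEquiv m B BitAction).sum_comp] at h
    refine le_trans (Finset.sum_le_sum fun a _ => ?_) h
    rw [blockEquiv_apply, ← received_eq_flatten]
    by_cases hy : received x a = y
    · simp [hy]
    · rw [if_neg hy]
      split_ifs
      exacts [Finset.prod_nonneg fun i _ => (hu.pos _ _).le, le_rfl]

/-! ### Locating a single deletion -/

/-- The word `x` is constant on its `j`-th segment of length `l`. -/
def ConstantSegment {B : ℕ} (l : ℕ) (x : Fin B → Bool) (j : ℕ) : Prop :=
  ∀ i i' : Fin B, i.1 / l = j → i'.1 / l = j → x i = x i'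

open Classical in
/-- Indicates that `i` lies in a constant segment of length `l`. -/
noncomputable def constInd {B : ℕ} (l : ℕ) (x : Fin B → Bool) (i : Fin B) : ℝ :=
  if ConstantSegment l x (i.1 / l) then 1 else 0

open Classical in
/-- A substitute for the inverse of the length of the run of `i`. -/
noncomputable def runWeight {B : ℕ} (l : ℕ) (x : Fin B → Bool) (i : Fin B) : ℝ :=
  if ConstantSegment l x (i.1 / l) then 1 / (2 * B) else 1 / (4 * l)

theorem card_segment_le {B : ℕ} {l : ℕ} (hl : 0 < l) (j : ℕ) :
    (Finset.univ.filter fun i : Fin B => i.1 / l = j).card ≤ l := by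
  refine (Finset.card_le_card_of_injOn (t := Finset.range l) (fun i => i.1 % l)
    (fun i _ => ?_) ?_).trans (Finset.card_range l).le
  · simpa using Nat.mod_lt _ hl
  · intro i hi i' hi' h
    simp only [Finset.coe_filter, Finset.mem_univ, true_and, Set.mem_ofPred_eq] at hi hi'
    ext
    rw [← Nat.div_add_mod i.1 l, ← Nat.div_add_mod i'.1 l, hi, hi']
    exact congrArg _ h

/-- The contributing positions lie in one run. At most `B` of them are in constant segments, with
weight `1 / (2B)`. The nonconstant segments among theirs can only be the first and the last, giving
at most `2l` positions of weight `1 / (4l)`. Each kind adds up to at most one half. -/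
theorem sum_runWeight_le {B l : ℕ} (hl : 0 < l) (hB : 0 < B) (x : Fin B → Bool) (z : List Bool) :
    ∑ i, (if received x (singleDeletion i) <+: z then runWeight l x i else 0) ≤ 1 := by
  classical
  have hl' : (0 : ℝ) < l := by exact_mod_cast hl
  have hB' : (0 : ℝ) < B := by exact_mod_cast hB
  rw [← Finset.sum_filter]
  set S := Finset.univ.filter fun i : Fin B => received x (singleDeletion i) <+: z with hS
  have hmem : ∀ i, i ∈ S ↔ received x (singleDeletion i) <+: z := by simp [hS]
  simp only [runWeight]
  rw [Finset.sum_ite, Finset.sum_const, Finset.sum_const, nsmul_eq_mul, nsmul_eq_mul]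
  have h1 : ((S.filter fun i => ConstantSegment l x (i.1 / l)).card : ℝ) ≤ B := by
    exact_mod_cast (Finset.card_le_univ _).trans (by simp)
  have h2 : ((S.filter fun i => ¬ConstantSegment l x (i.1 / l)).card : ℝ) ≤ 2 * l := by
    rcases S.eq_empty_or_nonempty with hE | hN
    · simp [hE]
    · have hmin := (hmem _).1 (S.min'_mem hN)
      have hmax := (hmem _).1 (S.max'_mem hN)
      have hsub : (S.filter fun i => ¬ConstantSegment l x (i.1 / l)) ⊆
          (Finset.univ.filter fun i : Fin B => i.1 / l = (S.min' hN).1 / l) ∪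
          (Finset.univ.filter fun i : Fin B => i.1 / l = (S.max' hN).1 / l) := by
        intro i hi
        simp only [Finset.mem_filter] at hi
        simp only [Finset.mem_union, Finset.mem_filter, Finset.mem_univ, true_and]
        by_contra! hne
        refine hi.2 fun k k' hk hk' => ?_
        have g1 : (S.min' hN).1 / l ≤ i.1 / l := Nat.div_le_div_right (S.min'_le i hi.1)
        have g2 : i.1 / l ≤ (S.max' hN).1 / l := Nat.div_le_div_right (S.le_max' i hi.1)
        have g : ∀ k : Fin B, k.1 / l = i.1 / l → x k = x (S.min' hN) := by
          intro k hk
          refine constant_of_received_singleDeletion hmin hmax ?_ ?_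
          · by_contra! hlt
            have : k.1 / l ≤ (S.min' hN).1 / l := Nat.div_le_div_right hlt.le
            omega
          · by_contra! hlt
            have : (S.max' hN).1 / l ≤ k.1 / l := Nat.div_le_div_right hlt.le
            omega
        rw [g k hk, g k' hk']
      have := (Finset.card_le_card hsub).trans (Finset.card_union_le _ _)
      have h3 := card_segment_le (B := B) hl ((S.min' hN).1 / l)
      have h4 := card_segment_le (B := B) hl ((S.max' hN).1 / l)
      exact_mod_cast (by omega : _ ≤ 2 * l)
  calc _ ≤ (B : ℝ) * (1 / (2 * B)) + 2 * l * (1 / (4 * l)) := by gcongr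
    _ = 1 := by field_simp; norm_num

theorem runWeight_pos {B l : ℕ} (hl : 0 < l) (hB : 0 < B) (x : Fin B → Bool) (i : Fin B) :
    0 < runWeight l x i := by
  have hl' : (0 : ℝ) < l := by exact_mod_cast hl
  have hB' : (0 : ℝ) < B := by exact_mod_cast hB
  rw [runWeight]
  split_ifs <;> positivity

theorem neg_log_runWeight_le {B l : ℕ} (hl : 0 < l) (x : Fin B → Bool)
    (i : Fin B) :
    -Real.log (runWeight l x i) ≤ Real.log (4 * l) + constInd l x i * Real.log (2 * B) := by
  have hl' : (1 : ℝ) ≤ l := by exact_mod_cast hl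
  rw [runWeight, constInd]
  split_ifs
  · rw [one_div, Real.log_inv, neg_neg, one_mul]
    have : 0 ≤ Real.log (4 * l) := Real.log_nonneg (by linarith)
    linarith
  · rw [one_div, Real.log_inv, neg_neg, zero_mul, add_zero]

/-! ### The block kernel and its cost -/

/-- A mixture of three ways of describing the action on a block: without deletions, with a single
deletion that is located by its run, and with the full list of deletions. -/
noncomputable def blockKernel {B : ℕ} (l : ℕ) (q : ℝ) (x : Fin B → Bool)
    (a : Fin B → BitAction) : ℝ :=
  (if deletions a = ∅ then 1 - q else 0) +
    q / 4 * (∑ i, if a = singleDeletion i then runWeight l x i else 0) +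
    q / 4 * (1 / (B : ℝ)) ^ (deletions a).card

/-- The sum is `(1 + 1 / B) ^ B`, which is at most `e`. -/
theorem sum_pow_card_le {B : ℕ} (hB : 0 < B) :
    ∑ D : Finset (Fin B), (1 / (B : ℝ)) ^ D.card ≤ 3 := by
  have h := Finset.prod_one_add (R := ℝ) (f := fun _ => 1 / (B : ℝ)) (Finset.univ : Finset (Fin B))
  simp only [Finset.prod_const, Finset.powerset_univ, Finset.card_univ, Fintype.card_fin] at h
  rw [← h]
  have hB' : (0 : ℝ) < B := by exact_mod_cast hB
  calc (1 + 1 / (B : ℝ)) ^ B ≤ Real.exp (1 / B) ^ B := by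
        gcongr
        rw [add_comm]
        exact Real.add_one_le_exp _
    _ = Real.exp 1 := by rw [← Real.exp_nat_mul]; congr 1; field_simp
    _ ≤ 3 := Real.exp_one_lt_d9.le.trans (by norm_num)

/-- The three parts have mass at most `1 - q`, `q / 4` and `3 * (q / 4)`. -/
theorem isBlockKernel_blockKernel {B l : ℕ} (hl : 0 < l) (hB : 0 < B) {q : ℝ} (hq : 0 < q)
    (hq1 : q ≤ 1) : IsBlockKernel (blockKernel (B := B) l q) where
  pos x a := by
    have hB' : (0 : ℝ) < B := by exact_mod_cast hB
    refine add_pos_of_nonneg_of_pos (add_nonneg ?_ (mul_nonneg (by linarith) ?_)) (by positivity)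
    · split_ifs <;> linarith
    · refine Finset.sum_nonneg fun i _ => ?_
      split_ifs
      exacts [(runWeight_pos hl hB x i).le, le_rfl]
  sum_le x z := by
    have hB' : (0 : ℝ) < B := by exact_mod_cast hB
    have h1 := sum_prefix_deletions_le x z (f := fun D => if D = ∅ then 1 - q else 0)
      (fun D => by split_ifs <;> linarith)
    have h2 := (sum_prefix_deletions_le x z (f := fun D => (1 / (B : ℝ)) ^ D.card)
      (fun D => by positivity)).trans (sum_pow_card_le hB)
    rw [Finset.sum_ite_eq' Finset.univ, if_pos (Finset.mem_univ _)] at h1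
    have h3 : ∑ a, (if received x a <+: z then
        ∑ i, (if a = singleDeletion i then runWeight l x i else 0) else 0) ≤ 1 := by
      refine le_trans (le_of_eq ?_) (sum_runWeight_le hl hB x z)
      have : ∀ a : Fin B → BitAction, (if received x a <+: z then
          ∑ i, (if a = singleDeletion i then runWeight l x i else 0) else 0) =
          ∑ i, if a = singleDeletion i then
            (if received x (singleDeletion i) <+: z then runWeight l x i else 0) else 0 := by
        intro a
        rw [Finset.ite_sum_zero]
        refine Finset.sum_congr rfl fun i _ => ?_
        by_cases h : a = singleDeletion i
        · subst h; simp
        · simp [h]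
      simp only [this]
      rw [Finset.sum_comm]
      simp
    have hsplit : ∀ a : Fin B → BitAction,
        (if received x a <+: z then blockKernel l q x a else 0) =
        (if received x a <+: z then (if deletions a = ∅ then 1 - q else 0) else 0) +
        q / 4 * (if received x a <+: z then
          ∑ i, (if a = singleDeletion i then runWeight l x i else 0) else 0) +
        q / 4 * (if received x a <+: z then (1 / (B : ℝ)) ^ (deletions a).card else 0) := by
      intro a
      split_ifs <;> simp [blockKernel, *]
    simp only [hsplit, Finset.sum_add_distrib, ← Finset.mul_sum]
    nlinarith

/-- The indicator of a deletion. -/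
def BitAction.delInd (b : BitAction) : ℝ := if b = .delete then 1 else 0

/-- The indicator of an error. -/
def BitAction.errInd (b : BitAction) : ℝ := if b = .keep then 0 else 1

theorem BitAction.delInd_nonneg (b : BitAction) : 0 ≤ b.delInd := by
  rw [delInd]; split_ifs <;> norm_num

theorem BitAction.errInd_nonneg (b : BitAction) : 0 ≤ b.errInd := by
  rw [errInd]; split_ifs <;> norm_num

/-- Only the best of the three descriptions is used. The bound is a sum over positions and pairs of
positions, so that its expectation is easy to take. -/
theorem neg_log_blockKernel_le {B l : ℕ} (hl : 0 < l) (hB : 0 < B) {q : ℝ} (hq : 0 < q)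
    (hq1 : q ≤ 1 / 2) (x : Fin B → Bool) (a : Fin B → BitAction) :
    -Real.log (blockKernel l q x a) ≤ 2 * q + ∑ i, ((a i).delInd *
      (Real.log (4 / q) + Real.log (4 * l) + constInd l x i * Real.log (2 * B)) +
      ∑ j ∈ Finset.univ.erase i, Real.log B * ((a i).delInd * (a j).errInd)) := by
  have hl' : (1 : ℝ) ≤ l := by exact_mod_cast hl
  have hB1 : (1 : ℝ) ≤ B := by exact_mod_cast hB
  have hB' : (0 : ℝ) < B := by linarith
  have hlB : 0 ≤ Real.log B := Real.log_nonneg hB1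
  have hl2B : 0 ≤ Real.log (2 * B) := Real.log_nonneg (by linarith)
  have hl4l : 0 ≤ Real.log (4 * l) := Real.log_nonneg (by linarith)
  have h4q : 0 ≤ Real.log (4 / q) := Real.log_nonneg (by rw [le_div_iff₀ hq]; linarith)
  have hc : ∀ i, 0 ≤ constInd l x i := by intro i; rw [constInd]; split_ifs <;> norm_num
  have hnn : ∀ i, 0 ≤ ∑ j ∈ Finset.univ.erase i,
      Real.log B * ((a i).delInd * (a j).errInd) := fun i =>
    Finset.sum_nonneg fun j _ => mul_nonneg hlB
      (mul_nonneg (BitAction.delInd_nonneg _) (BitAction.errInd_nonneg _))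
  have hn : ∀ i, 0 ≤ (a i).delInd *
      (Real.log (4 / q) + Real.log (4 * l) + constInd l x i * Real.log (2 * B)) := fun i =>
    mul_nonneg (BitAction.delInd_nonneg _)
      (add_nonneg (add_nonneg h4q hl4l) (mul_nonneg (hc i) hl2B))
  have t1 : 0 ≤ (if deletions a = ∅ then 1 - q else 0 : ℝ) := by split_ifs <;> linarith
  have t2' : ∀ i, 0 ≤ (if a = singleDeletion i then runWeight l x i else 0) := by
    intro i
    split_ifs
    exacts [(runWeight_pos hl hB x i).le, le_rfl]
  have t2 : 0 ≤ q / 4 * (∑ i, if a = singleDeletion i then runWeight l x i else 0) :=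
    mul_nonneg (by linarith) (Finset.sum_nonneg fun i _ => t2' i)
  have t3 : 0 < q / 4 * (1 / (B : ℝ)) ^ (deletions a).card := by positivity
  by_cases h0 : deletions a = ∅
  · have h1 : 1 - q ≤ blockKernel l q x a := by
      rw [blockKernel, if_pos h0]; linarith
    have h2 := Real.log_le_log (by linarith) h1
    have h3 := Real.one_sub_inv_le_log_of_pos (show 0 < 1 - q by linarith)
    have h4 : (1 - q)⁻¹ ≤ 1 + 2 * q := by
      rw [inv_le_iff_one_le_mul₀ (by linarith)]; nlinarith
    have := Finset.sum_nonneg fun i (_ : i ∈ Finset.univ) => add_nonneg (hn i) (hnn i)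
    linarith
  by_cases hs : ∃ i, a = singleDeletion i
  · obtain ⟨i, hi⟩ := hs
    have h1 : q / 4 * runWeight l x i ≤ blockKernel l q x a := by
      have := Finset.single_le_sum (fun i _ => t2' i) (Finset.mem_univ i)
      rw [if_pos hi] at this
      have := mul_le_mul_of_nonneg_left this (show 0 ≤ q / 4 by linarith)
      rw [blockKernel]; linarith
    have hr := runWeight_pos hl hB x i
    have h2 := Real.log_le_log (by positivity) h1
    rw [Real.log_mul (by positivity) hr.ne', ← inv_div, Real.log_inv] at h2
    have h3 := neg_log_runWeight_le hl x i
    have h4 := Finset.single_le_sum (fun i (_ : i ∈ Finset.univ) => add_nonneg (hn i) (hnn i))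
      (Finset.mem_univ i)
    have h5 : (a i).delInd = 1 := by simp [hi, singleDeletion, BitAction.delInd]
    have h6 := hnn i
    simp only [h5, one_mul] at h4 h6
    linarith
  · have h1 : q / 4 * (1 / (B : ℝ)) ^ (deletions a).card ≤ blockKernel l q x a := by
      rw [blockKernel]; linarith
    have h2 := Real.log_le_log t3 h1
    rw [Real.log_mul (by positivity) (by positivity), ← inv_div, Real.log_inv, Real.log_pow,
      one_div, Real.log_inv] at h2
    -- The pattern is not a single deletion, so each deleted `i` has another error `j`, whose pair
    -- term pays for `log B`.
    have h3 : ∀ i ∈ deletions a, Real.log (4 / q) + Real.log B ≤ (a i).delInd *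
      (Real.log (4 / q) + Real.log (4 * l) + constInd l x i * Real.log (2 * B)) +
      ∑ j ∈ Finset.univ.erase i, Real.log B * ((a i).delInd * (a j).errInd) := by
      intro i hi
      have hi' : a i = .delete := by simpa [deletions] using hi
      have h5 : (a i).delInd = 1 := by simp [hi', BitAction.delInd]
      obtain ⟨j, hj, hj'⟩ : ∃ j, j ≠ i ∧ a j ≠ .keep := by
        by_contra! hcon
        refine hs ⟨i, funext fun j => ?_⟩
        by_cases hj : j = i
        · simp [hj, singleDeletion, hi']
        · simp [hj, singleDeletion, hcon j hj]
      have h6 := Finset.single_le_sum (f := fun j => Real.log B * ((a i).delInd * (a j).errInd))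
        (fun j _ => mul_nonneg hlB
          (mul_nonneg (BitAction.delInd_nonneg (a i)) (BitAction.errInd_nonneg (a j))))
        (Finset.mem_erase.2 ⟨hj, Finset.mem_univ j⟩)
      have h7 : (a j).errInd = 1 := by simp [hj', BitAction.errInd]
      simp only [h5, h7, one_mul, mul_one] at h6 ⊢
      have := mul_nonneg (hc i) hl2B
      linarith
    have h4 := Finset.sum_le_sum h3
    have h5 := Finset.sum_le_sum_of_subset_of_nonneg (Finset.subset_univ (deletions a))
      (fun i _ _ => add_nonneg (hn i) (hnn i))
    rw [Finset.sum_const, nsmul_eq_mul] at h4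
    have h6 : (1 : ℝ) ≤ (deletions a).card := by
      exact_mod_cast (Finset.card_pos.2 (Finset.nonempty_iff_ne_empty.2 h0))
    nlinarith

theorem sum_blockCost_le {pd ps : ℝ} (hd : 0 ≤ pd) (hs : 0 ≤ ps) (h : pd + ps ≤ 1)
    {B l : ℕ} (hl : 0 < l) (hB : 0 < B) {q : ℝ} (hq : 0 < q)
    (hq1 : q ≤ 1 / 2) (x : Fin B → Bool) :
    ∑ a, patternProb pd ps a * -Real.log (blockKernel l q x a) ≤
      2 * q + B * (pd * (Real.log (4 / q) + Real.log (4 * l))) +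
        pd * Real.log (2 * B) * ∑ i, constInd l x i +
        B * B * (Real.log B * (pd * (pd + ps))) := by
  have hB1 : (1 : ℝ) ≤ B := by exact_mod_cast hB
  have hlB : 0 ≤ Real.log B := Real.log_nonneg hB1
  refine (Finset.sum_le_sum fun a _ => mul_le_mul_of_nonneg_left
    (neg_log_blockKernel_le hl hB hq hq1 x a) (patternProb_nonneg hd hs h a)).trans ?_
  have hD : ∑ b : BitAction, b.prob pd ps * b.delInd = pd := by
    rw [BitAction.sum_eq]; simp [BitAction.delInd, BitAction.prob]
  have hE : ∑ b : BitAction, b.prob pd ps * b.errInd = pd + ps := by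
    rw [BitAction.sum_eq]; simp [BitAction.errInd, BitAction.prob, add_comm]
  have e1 : ∀ i : Fin B, ∑ a : Fin B → BitAction, patternProb pd ps a * (a i).delInd = pd :=
    fun i => (sum_prod_mul_apply (BitAction.sum_prob pd ps) BitAction.delInd i).trans hD
  have e2 : ∀ i j : Fin B, i ≠ j → ∑ a : Fin B → BitAction,
      patternProb pd ps a * ((a i).delInd * (a j).errInd) = pd * (pd + ps) := fun i j hij => by
    have := sum_prod_mul_apply_mul_apply (BitAction.sum_prob pd ps) BitAction.delInd
      BitAction.errInd hij
    rw [hD, hE] at this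
    exact this
  set K := Real.log (4 / q) + Real.log (4 * l) with hK
  have step : ∀ a : Fin B → BitAction, patternProb pd ps a * (2 * q + ∑ i, ((a i).delInd *
      (K + constInd l x i * Real.log (2 * B)) +
      ∑ j ∈ Finset.univ.erase i, Real.log B * ((a i).delInd * (a j).errInd))) =
      patternProb pd ps a * (2 * q) + ∑ i, ((K + constInd l x i * Real.log (2 * B)) *
        (patternProb pd ps a * (a i).delInd) +
      ∑ j ∈ Finset.univ.erase i,
        Real.log B * (patternProb pd ps a * ((a i).delInd * (a j).errInd))) := by
    intro a
    rw [mul_add, Finset.mul_sum]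
    congr 1
    refine Finset.sum_congr rfl fun i _ => ?_
    rw [mul_add, Finset.mul_sum]
    congr 1
    · ring
    · exact Finset.sum_congr rfl fun j _ => by ring
  simp only [step]
  rw [Finset.sum_add_distrib, ← Finset.sum_mul, sum_patternProb, Finset.sum_comm]
  have step2 : ∀ i : Fin B, ∑ a : Fin B → BitAction, ((K + constInd l x i * Real.log (2 * B)) *
        (patternProb pd ps a * (a i).delInd) +
      ∑ j ∈ Finset.univ.erase i,
        Real.log B * (patternProb pd ps a * ((a i).delInd * (a j).errInd))) ≤
      pd * K + pd * Real.log (2 * B) * constInd l x i + B * (Real.log B * (pd * (pd + ps))) := by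
    intro i
    rw [Finset.sum_add_distrib, ← Finset.mul_sum, e1, Finset.sum_comm]
    have : ∑ j ∈ Finset.univ.erase i, ∑ a : Fin B → BitAction,
        Real.log B * (patternProb pd ps a * ((a i).delInd * (a j).errInd)) ≤
        B * (Real.log B * (pd * (pd + ps))) := by
      calc _ = ∑ j ∈ Finset.univ.erase i, Real.log B * (pd * (pd + ps)) := by
            refine Finset.sum_congr rfl fun j hj => ?_
            rw [← Finset.mul_sum, e2 i j (Finset.ne_of_mem_erase hj).symm]
        _ ≤ _ := by
            rw [Finset.sum_const, nsmul_eq_mul]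
            refine mul_le_mul_of_nonneg_right ?_ (by positivity)
            exact_mod_cast (Finset.card_le_univ _).trans (by simp)
    linarith
  have := Finset.sum_le_sum fun i (_ : i ∈ (Finset.univ : Finset (Fin B))) => step2 i
  simp only [Finset.sum_add_distrib, Finset.sum_const, Finset.card_univ, Fintype.card_fin,
    nsmul_eq_mul, ← Finset.mul_sum] at this ⊢
  linarith

/-! ### Large codes have few constant segments -/

theorem sum_blockEquiv {m B : ℕ} {α : Type*} [Fintype α] (f : (Fin B → α) → ℝ) :
    ∑ x : Fin (m * B) → α, ∏ i, f (block x i) = (∑ v, f v) ^ m := by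
  rw [← (blockEquiv m B α).symm.sum_comp]
  have : ∀ y : Fin m → Fin B → α, block ((blockEquiv m B α).symm y) = y := fun y => by
    rw [← blockEquiv_apply, Equiv.apply_symm_apply]
  simp only [this]
  rw [Fintype.sum_pow]

theorem constInd_finProdFinEquiv {k l : ℕ}
    (x : Fin (k * l) → Bool) (j : Fin k) (s : Fin l) :
    constInd l x (finProdFinEquiv (j, s)) =
      if ∀ s s', block x j s = block x j s' then 1 else 0 := by
  have hl : 0 < l := s.pos
  have hdiv : ∀ (j' : Fin k) (s' : Fin l), (finProdFinEquiv (j', s')).1 / l = j' := by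
    intro j' s'
    rw [finProdFinEquiv_apply_val, Nat.add_mul_div_left _ _ hl, Nat.div_eq_of_lt s'.2, zero_add]
  have : ConstantSegment l x j ↔ ∀ s s', block x j s = block x j s' := by
    constructor
    · intro h s s'
      exact h _ _ (hdiv j s) (hdiv j s')
    · intro h i i' hi hi'
      obtain ⟨⟨j1, s1⟩, rfl⟩ := finProdFinEquiv.surjective i
      obtain ⟨⟨j2, s2⟩, rfl⟩ := finProdFinEquiv.surjective i'
      rw [hdiv] at hi hi'
      obtain rfl := Fin.ext hi
      obtain rfl := Fin.ext hi'
      exact h s1 s2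
  rw [constInd, hdiv]
  by_cases h : ∀ s s', block x j s = block x j s'
  · rw [if_pos (this.2 h), if_pos h]
  · rw [if_neg (fun hc => h (this.1 hc)), if_neg h]

/-- Only two words are constant, so even with weight `2 ^ (l - 1)` they add no more than `2 ^ l`. -/
theorem sum_two_pow_constant_le {l : ℕ} (hl : 0 < l) :
    ∑ v : Fin l → Bool, (if ∀ s s', v s = v s' then (2 : ℝ) ^ (l - 1) else 1) ≤ 2 ^ (l + 1) := by
  have hcard : (Finset.univ.filter fun v : Fin l → Bool => ∀ s s', v s = v s').card ≤ 2 := by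
    rw [← Fintype.card_bool, ← Finset.card_univ]
    refine Finset.card_le_card_of_injOn (fun v => v ⟨0, hl⟩)
      (fun v _ => Finset.mem_coe.2 (Finset.mem_univ _)) ?_
    intro v hv w hw h
    simp only [Finset.coe_filter, Finset.mem_univ, true_and, Set.mem_ofPred_eq] at hv hw
    funext s
    rw [hv s ⟨0, hl⟩, hw s ⟨0, hl⟩]
    exact h
  have hcard2 : (Finset.univ.filter fun v : Fin l → Bool => ¬∀ s s', v s = v s').card ≤ 2 ^ l :=
    (Finset.card_le_univ _).trans (by simp)
  rw [Finset.sum_ite, Finset.sum_const, Finset.sum_const, nsmul_eq_mul, nsmul_eq_mul, mul_one]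
  have h1 : ((Finset.univ.filter fun v : Fin l → Bool => ∀ s s', v s = v s').card : ℝ) ≤ 2 := by
    exact_mod_cast hcard
  have h2 : ((Finset.univ.filter fun v : Fin l → Bool => ¬∀ s s', v s = v s').card : ℝ) ≤
      2 ^ l := by exact_mod_cast hcard2
  obtain ⟨l, rfl⟩ := Nat.exists_eq_add_of_lt hl
  simp only [zero_add, Nat.add_sub_cancel] at *
  have h3 := mul_le_mul_of_nonneg_right h1 (show (0 : ℝ) ≤ 2 ^ l by positivity)
  rw [pow_succ, pow_succ] at *
  linarith

/-- A constant segment has `l` positions, so the exponent gives it the factor `2 ^ (l - 1)`; the sum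
then factors over the segments. -/
theorem sum_exp_constInd_le {k l : ℕ} (hl : 0 < l) :
    ∑ x : Fin (k * l) → Bool,
      Real.exp (((l : ℝ) - 1) / l * Real.log 2 * ∑ i, constInd l x i) ≤ 2 ^ ((l + 1) * k) := by
  have hl' : (0 : ℝ) < l := by exact_mod_cast hl
  rw [pow_mul]
  refine le_trans (le_of_eq ?_) (pow_le_pow_left₀
    (Finset.sum_nonneg fun v _ => ?_) (sum_two_pow_constant_le hl) k)
  · rw [← sum_blockEquiv]
    refine Finset.sum_congr rfl fun x _ => ?_
    rw [← finProdFinEquiv.sum_comp, Fintype.sum_prod_type]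
    simp only [constInd_finProdFinEquiv, Finset.sum_const, Finset.card_univ, Fintype.card_fin,
      nsmul_eq_mul, Finset.mul_sum]
    rw [Real.exp_sum]
    refine Finset.prod_congr rfl fun j _ => ?_
    split_ifs
    · have : ((l : ℝ) - 1) / l * Real.log 2 * (l * 1) = ((l - 1 : ℕ) : ℝ) * Real.log 2 := by
        rw [Nat.cast_sub hl]
        push_cast
        field_simp
      rw [this, Real.exp_nat_mul, Real.exp_log two_pos]
    · simp
  · split_ifs <;> positivity

/-- Gibbs' inequality for the uniform law on `C` against the density `exp f / T`. -/
theorem sum_div_card_le_log {α : Type*} [Fintype α] {C : Finset α} (hC : C.Nonempty) (f : α → ℝ)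
    {T : ℝ} (hT0 : 0 < T) (hT : ∑ x, Real.exp (f x) ≤ T) :
    (∑ x ∈ C, f x) / C.card ≤ Real.log T - Real.log C.card := by
  have hc : (0 : ℝ) < C.card := by exact_mod_cast hC.card_pos
  set t := Real.log (T / C.card) with ht
  have h1 : ∑ x ∈ C, (f x - t + 1) ≤ C.card := by
    calc _ ≤ ∑ x ∈ C, Real.exp (f x - t) :=
          Finset.sum_le_sum fun x _ => Real.add_one_le_exp _
      _ ≤ ∑ x, Real.exp (f x - t) :=
          Finset.sum_le_sum_of_subset_of_nonneg (Finset.subset_univ _)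
            fun x _ _ => (Real.exp_pos _).le
      _ = (∑ x, Real.exp (f x)) / (T / C.card) := by
          rw [Finset.sum_div]
          refine Finset.sum_congr rfl fun x _ => ?_
          rw [Real.exp_sub, ht, Real.exp_log (by positivity)]
      _ ≤ T / (T / C.card) := by gcongr
      _ = C.card := by field_simp
  rw [Finset.sum_add_distrib, Finset.sum_sub_distrib, Finset.sum_const, Finset.sum_const,
    nsmul_eq_mul, nsmul_eq_mul] at h1
  rw [← Real.log_div hT0.ne' hc.ne', div_le_iff₀ hc]
  linarith

/-- A large code has few constant segments. -/
theorem sum_constInd_le {m k l : ℕ} (hl : 1 < l) {C : Finset (Fin (m * (k * l)) → Bool)}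
    (hC : C.Nonempty) :
    ((l : ℝ) - 1) / l * Real.log 2 *
      ((∑ x ∈ C, ∑ b, ∑ i, constInd l (block x b) i) / C.card) ≤
      m * k * (l + 1) * Real.log 2 - Real.log C.card := by
  have h := sum_div_card_le_log hC (fun x =>
    ((l : ℝ) - 1) / l * Real.log 2 * ∑ b, ∑ i, constInd l (block x b) i)
    (T := (2 ^ ((l + 1) * k)) ^ m) (by positivity) ?_
  · rw [← Finset.mul_sum, mul_div_assoc] at h
    refine h.trans_eq ?_
    rw [Real.log_pow, Real.log_pow]
    push_cast
    ring
  · refine le_trans (le_of_eq ?_) (pow_le_pow_left₀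
      (Finset.sum_nonneg fun v _ => (Real.exp_pos _).le) (sum_exp_constInd_le (by omega)) m)
    rw [← sum_blockEquiv]
    refine Finset.sum_congr rfl fun x _ => ?_
    rw [Finset.mul_sum, Real.exp_sum]

/-! ### The bound for a fixed block length -/

theorem sum_patternProb_mul_block {pd ps : ℝ} {m B : ℕ} (f : Fin m → (Fin B → BitAction) → ℝ) :
    ∑ a : Fin (m * B) → BitAction, patternProb pd ps a * ∑ b, f b (block a b) =
      ∑ b, ∑ a, patternProb pd ps a * f b a := by
  simp only [Finset.mul_sum]
  rw [Finset.sum_comm]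
  refine Finset.sum_congr rfl fun b _ => ?_
  rw [← sum_prod_mul_apply (sum_patternProb pd ps B) (f b) b,
    ← (blockEquiv m B BitAction).sum_comp]
  refine Finset.sum_congr rfl fun a _ => ?_
  rw [blockEquiv_apply, patternProb, prod_block a (fun b => b.prob pd ps)]
  rfl

theorem averageCost_le {pd ps : ℝ} (hd : 0 ≤ pd) (hs : 0 ≤ ps) (h : pd + ps ≤ 1)
    {m k l : ℕ} (hl : 1 < l) (hk : 0 < k) {q : ℝ} (hq : 0 < q) (hq1 : q ≤ 1 / 2)
    {C : Finset (Fin (m * (k * l)) → Bool)} (hC : C.Nonempty) {B : ℝ} (hB : B = k * l) :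
    (∑ x ∈ C, ∑ a, patternProb pd ps a *
      -Real.log (∏ b, blockKernel l q (block x b) (block a b))) / C.card ≤
      m * (2 * q + B * (pd * (Real.log (4 / q) + Real.log (4 * l))) +
        B * B * (Real.log B * (pd * (pd + ps)))) +
      pd * Real.log (2 * B) *
        ((m * k * (l + 1) - Real.log C.card / Real.log 2) * (l / (l - 1))) := by
  have hc : (0 : ℝ) < C.card := by exact_mod_cast hC.card_pos
  have hkl : 0 < k * l := Nat.mul_pos hk (by omega)
  have hBc : ((k * l : ℕ) : ℝ) = B := by rw [hB]; push_cast; ring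
  have hB1 : (1 : ℝ) ≤ B := by rw [← hBc]; exact_mod_cast hkl
  have hl1 : (1 : ℝ) < l := by exact_mod_cast hl
  have hlog2 := Real.log_pos one_lt_two
  have h2B : 0 ≤ Real.log (2 * B) := Real.log_nonneg (by linarith)
  have hker := isBlockKernel_blockKernel (B := k * l) (l := l) (by omega) hkl hq (by linarith)
  set Z := 2 * q + B * (pd * (Real.log (4 / q) + Real.log (4 * l))) +
        B * B * (Real.log B * (pd * (pd + ps))) with hZ
  have h1 : ∀ x : Fin (m * (k * l)) → Bool, ∑ a, patternProb pd ps a *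
      -Real.log (∏ b, blockKernel l q (block x b) (block a b)) ≤
      m * Z + pd * Real.log (2 * B) * ∑ b, ∑ i, constInd l (block x b) i := by
    intro x
    have e : ∀ a : Fin (m * (k * l)) → BitAction,
        -Real.log (∏ b, blockKernel l q (block x b) (block a b)) =
        ∑ b, -Real.log (blockKernel l q (block x b) (block a b)) := by
      intro a
      rw [Real.log_prod fun b _ => (hker.pos _ _).ne', Finset.sum_neg_distrib]
    simp only [e]
    rw [sum_patternProb_mul_block fun b a => -Real.log (blockKernel l q (block x b) a)]
    refine (Finset.sum_le_sum fun b _ =>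
      sum_blockCost_le hd hs h (by omega) hkl hq hq1 (block x b)).trans_eq ?_
    rw [hBc, hZ]
    simp only [Finset.sum_add_distrib, Finset.sum_const, Finset.card_univ, Fintype.card_fin,
      nsmul_eq_mul, ← Finset.mul_sum]
    ring
  have h2 := Finset.sum_le_sum fun x (_ : x ∈ C) => h1 x
  rw [Finset.sum_add_distrib, Finset.sum_const, nsmul_eq_mul, ← Finset.mul_sum] at h2
  have h3 := sum_constInd_le (m := m) (k := k) hl hC
  set G := ∑ x ∈ C, ∑ b, ∑ i, constInd l (block x b) i
  have h4 : G / C.card ≤ (m * k * (l + 1) - Real.log C.card / Real.log 2) * (l / (l - 1)) := by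
    have hpos : 0 < ((l : ℝ) - 1) / l * Real.log 2 := by
      have : (0 : ℝ) < l - 1 := by linarith
      positivity
    refine le_of_mul_le_mul_left (h3.trans_eq ?_) hpos
    have : (l : ℝ) - 1 ≠ 0 := by linarith
    field_simp
  calc _ ≤ (C.card * (m * Z) + pd * Real.log (2 * B) * G) / C.card := by gcongr
    _ = m * Z + pd * Real.log (2 * B) * (G / C.card) := by field_simp
    _ ≤ _ := by gcongr

/-- The converse per letter, with the number of blocks sent to infinity. The quotient `(l * (1 - R)
+ 1) / (l - 1)` bounds the mean share of positions in constant segments. -/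
theorem AchievableRate.mul_log_two_le {pd ps R : ℝ} (hR : AchievableRate pd ps R) (hR0 : 0 ≤ R)
    (hd : 0 ≤ pd) (hs : 0 ≤ ps) (h : pd + ps ≤ 1)
    {k l : ℕ} (hl : 1 < l) (hk : 0 < k) {q : ℝ} (hq : 0 < q) (hq1 : q ≤ 1 / 2)
    {B : ℝ} (hB : B = k * l) :
    R * Real.log 2 ≤ Real.log 2 - actionEntropy pd ps + 2 * q / B +
      pd * (Real.log (4 / q) + Real.log (4 * l)) + Real.log B * (pd * (B * (pd + ps))) +
      pd * Real.log (2 * B) * ((l * (1 - R) + 1) / (l - 1)) := by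
  have hkl : 0 < k * l := Nat.mul_pos hk (by omega)
  have hBc : ((k * l : ℕ) : ℝ) = B := by rw [hB]; push_cast; ring
  have hB1 : (1 : ℝ) ≤ B := by rw [← hBc]; exact_mod_cast hkl
  have hl1 : (1 : ℝ) < l := by exact_mod_cast hl
  have hl0 : (0 : ℝ) < l - 1 := by linarith
  have hlog2 := Real.log_pos one_lt_two
  have h2B : 0 ≤ Real.log (2 * B) := Real.log_nonneg (by linarith)
  -- Since `Real.log 0 = 0`, this is a valid bound even if an action has probability zero.
  set M := ∑ b : BitAction, |Real.log (b.prob pd ps)| with hMdef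
  have hM : ∀ b : BitAction, -Real.log (b.prob pd ps) ≤ M := fun b =>
    (neg_le_abs _).trans (Finset.single_le_sum (f := fun b : BitAction =>
      |Real.log (b.prob pd ps)|) (fun _ _ => abs_nonneg _) (Finset.mem_univ b))
  have hM0 : 0 ≤ M := Finset.sum_nonneg fun _ _ => abs_nonneg _
  refine le_of_forall_pos_le_add fun e he => ?_
  -- A decoding failure costs at most `M + R log 2` per letter, so failure probability `e / 2 / D`
  -- uses up `e / 2`. The other half absorbs `1 + log 2` once `m ≥ 4 / e`.
  set D := M + R * Real.log 2 + 1 with hD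
  have hD0 : 0 < D := by positivity
  obtain ⟨N, hN⟩ := eventually_atTop.1 (hR (e / 2 / D) (by positivity))
  obtain ⟨m, hm1, hm2⟩ : ∃ m : ℕ, N + 1 ≤ m ∧ 4 / e ≤ m := by
    obtain ⟨m, hm⟩ := exists_nat_ge (4 / e)
    exact ⟨max m (N + 1), le_max_right _ _, hm.trans (by exact_mod_cast le_max_left _ _)⟩
  obtain ⟨C, g, hC, hcard, hsucc⟩ := hN (m * (k * l)) (by nlinarith)
  have hc : (0 : ℝ) < C.card := by exact_mod_cast hC.card_pos
  have hc1 : (1 : ℝ) ≤ C.card := by exact_mod_cast hC.card_pos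
  have hker := (isBlockKernel_blockKernel (B := k * l) (l := l) (by omega) hkl hq
    (by linarith)).isPatternKernel m
  have conv := successProb_mul_log_card_le hd hs h hker hC g hM
  have cost := averageCost_le hd hs h hl hk hq hq1 hC hB
  have hm0 : (0 : ℝ) < m := by exact_mod_cast (by omega : 0 < m)
  have hn : ((m * (k * l) : ℕ) : ℝ) = m * B := by rw [Nat.cast_mul, hBc]
  rw [hn] at conv hcard
  set S := successProb pd ps C g
  have hlogC : m * B * R * Real.log 2 ≤ Real.log C.card := by
    have := Real.log_le_log (by positivity) hcard
    rwa [Real.log_rpow two_pos] at this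
  have hl3 : m * k * (l + 1) - Real.log C.card / Real.log 2 ≤ m * B * ((l + 1) / l - R) := by
    have : m * B * R ≤ Real.log C.card / Real.log 2 := by rwa [le_div_iff₀ hlog2]
    have e1 : m * B * ((l + 1) / l - R) = m * k * (l + 1) - m * B * R := by
      rw [hB]; field_simp
    linarith
  have hl4 : pd * Real.log (2 * B) *
        ((m * k * (l + 1) - Real.log C.card / Real.log 2) * (l / (l - 1))) ≤
      m * B * (pd * Real.log (2 * B) * ((l * (1 - R) + 1) / (l - 1))) := by
    calc _ ≤ pd * Real.log (2 * B) * (m * B * ((l + 1) / l - R) * (l / (l - 1))) := by gcongr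
      _ = _ := by field_simp; ring
  have hS : S * Real.log C.card ≥ m * B * R * Real.log 2 - m * B * (e / 2 / D) * (R * Real.log 2) ∧
      (1 - S) * (m * B * M) ≤ m * B * (e / 2 / D) * M := by
    constructor
    · have hS0 : 0 ≤ S := by
        refine div_nonneg (Finset.sum_nonneg fun x _ => Finset.sum_nonneg fun a _ => ?_) hc.le
        split_ifs
        exacts [patternProb_nonneg hd hs h a, le_rfl]
      have h1 := mul_le_mul_of_nonneg_left hlogC hS0
      have h2 := mul_le_mul_of_nonneg_right hsucc
        (show 0 ≤ m * B * R * Real.log 2 by positivity)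
      linarith
    · have := mul_le_mul_of_nonneg_right (show 1 - S ≤ e / 2 / D by linarith)
        (show 0 ≤ m * B * M by positivity)
      linarith
  have hDe : (e / 2 / D) * M + (e / 2 / D) * (R * Real.log 2) ≤ e / 2 := by
    have : (e / 2 / D) * D = e / 2 := by field_simp
    have h2 : 0 ≤ e / 2 / D := by positivity
    rw [hD] at this
    rw [hD] at h2
    linarith
  have hsmall : 1 + Real.log 2 ≤ m * B * (e / 2) := by
    have h1 : 4 ≤ m * e := by rwa [div_le_iff₀ he] at hm2
    have h2 := Real.log_two_lt_d9
    nlinarith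
  have hmB : 0 < m * B := by positivity
  refine le_of_mul_le_mul_left ?_ hmB
  have hqB : m * B * (2 * q / B) = m * (2 * q) := by field_simp
  have hDe' := mul_le_mul_of_nonneg_left hDe hmB.le
  have expand : m * B * (Real.log 2 - actionEntropy pd ps + 2 * q / B +
      pd * (Real.log (4 / q) + Real.log (4 * l)) + Real.log B * (pd * (B * (pd + ps))) +
      pd * Real.log (2 * B) * ((l * (1 - R) + 1) / (l - 1)) + e) =
      m * B * Real.log 2 - m * B * actionEntropy pd ps + m * (2 * q + B * (pd * (Real.log (4 / q) +
        Real.log (4 * l))) + B * B * (Real.log B * (pd * (pd + ps)))) +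
      m * B * (pd * Real.log (2 * B) * ((l * (1 - R) + 1) / (l - 1))) + m * B * e := by
    rw [mul_add, mul_add, mul_add, mul_add, mul_add, hqB]
    ring
  rw [expand]
  linarith [hS.1, hS.2]

/-! ### Choice of parameters for small error probabilities -/

/-- Chain rule: first whether the bit is deleted, then whether a surviving bit is flipped. -/
theorem actionEntropy_eq {pd ps : ℝ} (hd1 : pd < 1) :
    actionEntropy pd ps =
      Real.binEntropy pd + (1 - pd) * Real.binEntropy (ps / (1 - pd)) := by
  have h1 : 1 - pd ≠ 0 := by linarith
  set r := ps / (1 - pd) with hr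
  have e1 : ps = (1 - pd) * r := by rw [hr]; field_simp
  have e2 : 1 - pd - ps = (1 - pd) * (1 - r) := by rw [mul_sub, ← e1]; ring
  rw [Real.binEntropy_eq_negMulLog_add_negMulLog_one_sub,
    Real.binEntropy_eq_negMulLog_add_negMulLog_one_sub]
  have : actionEntropy pd ps =
      Real.negMulLog (1 - pd - ps) + Real.negMulLog ps + Real.negMulLog pd := by
    simp only [actionEntropy, BitAction.sum_eq, BitAction.prob, Real.negMulLog]
    ring
  rw [this, e2, e1, Real.negMulLog_mul, Real.negMulLog_mul]
  ring

theorem neg_mul_log_le_binEntropy {p : ℝ} (hp : 0 ≤ p) (hp1 : p ≤ 1) :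
    p * -Real.log p ≤ Real.binEntropy p := by
  rw [Real.binEntropy_eq_negMulLog_add_negMulLog_one_sub]
  have h1 := Real.negMulLog_nonneg (sub_nonneg.2 hp1) (by linarith)
  have h2 : Real.negMulLog p = p * -Real.log p := by rw [Real.negMulLog]; ring
  linarith

/-- For small `p` this absorbs terms linear in `p` into a small fraction of the entropy. -/
theorem mul_le_binEntropy {p A : ℝ} (hp : 0 ≤ p) (hp1 : p ≤ 1) (hA : p ≤ Real.exp (-A)) :
    p * A ≤ Real.binEntropy p := by
  refine le_trans ?_ (neg_mul_log_le_binEntropy hp hp1)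
  rcases hp.eq_or_lt with rfl | hp
  · simp
  · have := (Real.log_le_iff_le_exp hp).2 hA
    nlinarith

/-- The quotient `η / (s * l)` is at least 2, so rounding it down loses at most a factor of two. -/
theorem exists_blockCount {s η : ℝ} {l : ℕ} (hl : 0 < l) (hs : 0 < s) (hη : s ≤ η / (2 * l)) :
    ∃ k : ℕ, 0 < k ∧ (k * l : ℝ) * s ≤ η ∧ η ≤ 2 * ((k * l : ℝ) * s) := by
  have hl' : (0 : ℝ) < l := by exact_mod_cast hl
  have ht : 2 ≤ η / (s * l) := by
    rw [le_div_iff₀ (by positivity)] at hη ⊢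
    linarith
  have h1 := Nat.floor_le (show 0 ≤ η / (s * l) by linarith)
  have h2 := Nat.lt_floor_add_one (η / (s * l))
  refine ⟨⌊η / (s * l)⌋₊, Nat.floor_pos.2 (by linarith), ?_, ?_⟩
  · rw [le_div_iff₀ (by positivity)] at h1
    linarith
  · have h3 : η / (s * l) ≤ 2 * ⌊η / (s * l)⌋₊ := by linarith
    rw [div_le_iff₀ (by positivity)] at h3
    linarith

/-- The mixture weight of the blocks with deletions. -/
theorem exists_mixtureWeight {pd ps η : ℝ} (hd : 0 ≤ pd) (hs : 0 ≤ ps) (hη : 0 < η) :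
    ∃ q, 0 < q ∧ q ≤ η ∧ pd * Real.log (η / q) ≤ ps := by
  rcases hd.eq_or_lt with rfl | hd
  · exact ⟨η, hη, le_rfl, by simpa using hs⟩
  -- When `B * (pd + ps)` is about `η`, this is about `B * pd`, which approximates the probability
  -- of a deletion in a block.
  · refine ⟨η * (pd / (pd + ps)), by positivity, ?_, ?_⟩
    · have : pd / (pd + ps) ≤ 1 := by rw [div_le_one (by positivity)]; linarith
      nlinarith
    · have e : η / (η * (pd / (pd + ps))) = ps / pd + 1 := by field_simp; ring
      rw [e]
      have h := Real.log_le_sub_one_of_pos (show 0 < ps / pd + 1 by positivity)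
      calc _ ≤ pd * (ps / pd) := mul_le_mul_of_nonneg_left (by linarith) hd.le
        _ = ps := by field_simp

theorem AchievableRate.mul_log_two_le_of_small {pd ps R ε η : ℝ} {l : ℕ}
    (hR : AchievableRate pd ps R) (hR0 : 0 ≤ R)
    (hd : 0 ≤ pd) (hd1 : pd < 1) (hs : 0 ≤ ps) (h : pd + ps ≤ 1) (hpos : 0 < pd + ps)
    (hε : 0 < ε) (hl : 1 < l) (hlε : 40 / ε ≤ l) (hη : 0 < η) (hηε : η ≤ ε / 10)
    (hη2 : η ≤ 1 / 2) (hsum : pd + ps ≤ η / (2 * l)) (hpd : pd ≤ ε / 10)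
    (hE : Real.binEntropy pd + Real.binEntropy (ps / (1 - pd)) ≤ ε / 40)
    (h1 : pd ≤ Real.exp (-(10 / ε * (4 + Real.log (4 / η) + Real.log (4 * l)))))
    (h2 : ps / (1 - pd) ≤ Real.exp (-(50 / ε))) :
    R * Real.log 2 ≤ Real.log 2 -
      (1 - ε) * (Real.binEntropy pd + Real.binEntropy (ps / (1 - pd))) := by
  have hp0 : 0 ≤ ps / (1 - pd) := div_nonneg hs (by linarith)
  have hp1 : ps / (1 - pd) ≤ 1 := by rw [div_le_one (by linarith)]; linarith
  have hps : ps ≤ ps / (1 - pd) := by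
    rw [le_div_iff₀ (by linarith)]
    linarith [mul_nonneg hs hd]
  have hE1 := Real.binEntropy_nonneg hd hd1.le
  have hE2 := Real.binEntropy_nonneg hp0 hp1
  have b1 := mul_le_binEntropy hd hd1.le h1
  have b2 := mul_le_binEntropy hp0 hp1 h2
  have b3 := neg_mul_log_le_binEntropy hd hd1.le
  have hent := actionEntropy_eq (ps := ps) hd1
  set E1 := Real.binEntropy pd
  set E2 := Real.binEntropy (ps / (1 - pd))
  -- If `R` is this small the claim holds at once; otherwise `R` is close to one, which is what
  -- limits the constant segments.
  by_cases hlow : R * Real.log 2 ≤ Real.log 2 - (E1 + E2)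
  · have := mul_nonneg hε.le (add_nonneg hE1 hE2)
    linarith
  push Not at hlow
  have hlog2 := Real.log_two_gt_d9
  have hl1 : (1 : ℝ) < l := by exact_mod_cast hl
  have hl2 : (2 : ℝ) ≤ l := by exact_mod_cast hl
  obtain ⟨k, hk, hk1, hk2⟩ := exists_blockCount (by omega : 0 < l) hpos hsum
  obtain ⟨q, hq, hqη, hqlog⟩ := exists_mixtureWeight hd hs hη
  have main := hR.mul_log_two_le hR0 hd hs h hl hk hq (by linarith) (B := k * l) rfl
  set B : ℝ := k * l with hB
  have hB1 : (1 : ℝ) ≤ B := by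
    rw [hB]; exact_mod_cast Nat.mul_pos hk (by omega : 0 < l)
  -- By the choice of `B`, `q ≤ η ≤ 2 * B * (pd + ps)`.
  have t1 : 2 * q / B ≤ 4 * (pd + ps) := by
    rw [div_le_iff₀ (by linarith)]; linarith
  have hK : Real.log (4 / q) = Real.log (4 / η) + Real.log (η / q) := by
    rw [← Real.log_mul (by positivity) (by positivity)]
    congr 1
    field_simp
  have t2 : pd * (Real.log (4 / q) + Real.log (4 * l)) ≤
      pd * (Real.log (4 / η) + Real.log (4 * l)) + ps := by
    rw [hK]; linarith
  -- Here `2 * B * pd ≤ 2 * η ≤ 1`, so `log (2 * B) ≤ -log pd`.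
  have t3 : pd * Real.log (2 * B) ≤ E1 := by
    refine le_trans ?_ b3
    rcases hd.eq_or_lt with h0 | h0
    · simp [← h0]
    · refine mul_le_mul_of_nonneg_left ?_ hd
      rw [← Real.log_inv]
      refine Real.log_le_log (by linarith) ?_
      rw [le_inv_comm₀ (by linarith) h0, ← one_div, le_div_iff₀ (by linarith)]
      linarith [mul_nonneg (zero_le_one.trans hB1) hs]
  have t4 : Real.log B * (pd * (B * (pd + ps))) ≤ E1 * η := by
    have hlogB : Real.log B ≤ Real.log (2 * B) := Real.log_le_log (by linarith) (by linarith)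
    have hlogB0 : 0 ≤ Real.log B := Real.log_nonneg hB1
    calc _ = pd * Real.log B * (B * (pd + ps)) := by ring
      _ ≤ E1 * η := by
        refine mul_le_mul ((mul_le_mul_of_nonneg_left hlogB hd).trans t3) hk1 (by positivity) hE1
  have hR1 : 1 - R ≤ 2 * (E1 + E2) := by
    have := mul_nonneg (sub_nonneg.2 hR.le_one) (show 0 ≤ Real.log 2 - 1 / 2 by linarith)
    linarith
  have hl40 : 40 ≤ ε * l := by rw [div_le_iff₀ hε] at hlε; linarith
  have t5 : (l * (1 - R) + 1) / (l - 1) ≤ 3 / 10 * ε := by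
    rw [div_le_iff₀ (by linarith)]
    have : l * (1 - R) ≤ l * (ε / 20) := mul_le_mul_of_nonneg_left (by linarith) (by linarith)
    have := mul_le_mul_of_nonneg_left hl2 hε.le
    linarith
  have t6 : pd * Real.log (2 * B) * ((l * (1 - R) + 1) / (l - 1)) ≤ E1 * (3 / 10 * ε) := by
    have h2B : 0 ≤ Real.log (2 * B) := Real.log_nonneg (by linarith)
    calc _ ≤ pd * Real.log (2 * B) * (3 / 10 * ε) :=
          mul_le_mul_of_nonneg_left t5 (by positivity)
      _ ≤ _ := mul_le_mul_of_nonneg_right t3 (by positivity)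
  have t7 : pd * (4 + Real.log (4 / η) + Real.log (4 * l)) ≤ ε / 10 * E1 := by
    have := mul_le_mul_of_nonneg_left b1 (show 0 ≤ ε / 10 by positivity)
    refine le_trans (le_of_eq ?_) this
    field_simp
  have t8 : 5 * ps ≤ ε / 10 * E2 := by
    have := mul_le_mul_of_nonneg_left b2 (show 0 ≤ ε / 10 by positivity)
    have e : ε / 10 * (ps / (1 - pd) * (50 / ε)) = 5 * (ps / (1 - pd)) := by
      field_simp; ring
    linarith
  have t9 : pd * E2 ≤ ε / 10 * E2 := mul_le_mul_of_nonneg_right hpd hE2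
  have t10 : E1 * η ≤ E1 * (ε / 10) := mul_le_mul_of_nonneg_left hηε hE1
  have := mul_nonneg hε.le hE1
  have := mul_nonneg hε.le hE2
  rw [hent] at main
  linarith

/-! ### From every `ε` to a single error term -/

theorem delSubCapacity_le_one (pd ps : ℝ) : delSubCapacity pd ps ≤ 1 :=
  csSup_le ⟨0, achievableRate_zero pd ps⟩ fun _ hR => AchievableRate.le_one hR

theorem eventually_delSubCapacity_le {ε : ℝ} (hε : 0 < ε) :
    ∀ᶠ p : ℝ × ℝ in 𝓝 (0, 0), 0 ≤ p.1 → p.1 < 1 → 0 ≤ p.2 → p.1 + p.2 ≤ 1 →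
      delSubCapacity p.1 p.2 ≤
        1 - (1 - ε) * (entropyBits p.1 + entropyBits (p.2 / (1 - p.1))) := by
  obtain ⟨l, hl, hlε⟩ : ∃ l : ℕ, 1 < l ∧ 40 / ε ≤ l := by
    obtain ⟨l, hl⟩ := exists_nat_ge (40 / ε)
    exact ⟨max l 2, by simp, hl.trans (by exact_mod_cast le_max_left _ _)⟩
  have hl0 : (0 : ℝ) < l := by exact_mod_cast (by omega : 0 < l)
  set η := min (ε / 10) (1 / 2) with hη
  have hη0 : 0 < η := by positivity
  have cr : ContinuousAt (fun p : ℝ × ℝ => p.2 / (1 - p.1)) (0, 0) :=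
    continuousAt_snd.div (continuousAt_const.sub continuousAt_fst) (by simp)
  have e1 : ∀ᶠ p : ℝ × ℝ in 𝓝 (0, 0), p.1 + p.2 < η / (2 * l) :=
    (continuousAt_fst.add continuousAt_snd).eventually_lt continuousAt_const
      (by simpa using by positivity)
  have e2 : ∀ᶠ p : ℝ × ℝ in 𝓝 (0, 0), p.1 < ε / 10 :=
    continuousAt_fst.eventually_lt continuousAt_const (by simpa using by positivity)
  have e3 : ∀ᶠ p : ℝ × ℝ in 𝓝 (0, 0),
      Real.binEntropy p.1 + Real.binEntropy (p.2 / (1 - p.1)) < ε / 40 := by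
    refine ContinuousAt.eventually_lt ?_ continuousAt_const (by simpa using by positivity)
    exact (Real.binEntropy_continuous.continuousAt.comp continuousAt_fst).add
      (Real.binEntropy_continuous.continuousAt.comp cr)
  have e4 : ∀ᶠ p : ℝ × ℝ in 𝓝 (0, 0),
      p.1 < Real.exp (-(10 / ε * (4 + Real.log (4 / η) + Real.log (4 * l)))) :=
    continuousAt_fst.eventually_lt continuousAt_const (Real.exp_pos _)
  have e5 : ∀ᶠ p : ℝ × ℝ in 𝓝 (0, 0), p.2 / (1 - p.1) < Real.exp (-(50 / ε)) :=
    cr.eventually_lt continuousAt_const (by simpa using Real.exp_pos _)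
  filter_upwards [e1, e2, e3, e4, e5] with p h1 h2 h3 h4 h5 hd hd1 hs h
  have hlog2 := Real.log_pos one_lt_two
  -- The block length is of order `1 / (pd + ps)`, so the noiseless channel is treated apart.
  rcases (add_nonneg hd hs).eq_or_lt with h0 | h0
  · have hp1 : p.1 = 0 := by linarith
    have hp2 : p.2 = 0 := by linarith
    simpa [hp1, hp2, entropyBits] using delSubCapacity_le_one 0 0
  · have key : ∀ R, AchievableRate p.1 p.2 R → 0 ≤ R →
        R ≤ 1 - (1 - ε) * (entropyBits p.1 + entropyBits (p.2 / (1 - p.1))) := by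
      intro R hR hR0
      have := hR.mul_log_two_le_of_small hR0 hd hd1 hs h h0 hε hl hlε hη0 (min_le_left _ _)
        (min_le_right _ _) h1.le h2.le h3.le h4.le h5.le
      refine le_of_mul_le_mul_right (this.trans_eq ?_) hlog2
      simp only [entropyBits]
      field_simp
    refine csSup_le ⟨0, achievableRate_zero _ _⟩ fun R hR => ?_
    rcases le_total 0 R with hR0 | hR0
    · exact key R hR hR0
    · exact hR0.trans (key 0 (achievableRate_zero _ _) le_rfl)

theorem entropyBits_nonneg {p : ℝ} (hp : 0 ≤ p) (hp1 : p ≤ 1) : 0 ≤ entropyBits p :=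
  div_nonneg (Real.binEntropy_nonneg hp hp1) (Real.log_nonneg one_le_two)

open Classical in
/-- The smallest nonnegative error term for which the capacity bound holds, on the set of the
channel parameters with a positive entropy. -/
noncomputable def capacityError (p : ℝ × ℝ) : ℝ :=
  if (0 ≤ p.1 ∧ p.1 < 1 ∧ 0 ≤ p.2 ∧ p.1 + p.2 ≤ 1) ∧
      0 < entropyBits p.1 + entropyBits (p.2 / (1 - p.1)) then
    max 0 (1 - (1 - delSubCapacity p.1 p.2) /
      (entropyBits p.1 + entropyBits (p.2 / (1 - p.1))))
  else 0

theorem capacityError_nonneg (p : ℝ × ℝ) : 0 ≤ capacityError p := by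
  rw [capacityError]
  split_ifs
  exacts [le_max_left _ _, le_rfl]

/-- Near the origin every fixed positive `ε` is an admissible error, and `capacityError` never
exceeds a nonnegative admissible one. -/
theorem tendsto_capacityError : Tendsto capacityError (𝓝 (0, 0)) (𝓝 0) := by
  refine tendsto_order.2 ⟨fun a ha => Eventually.of_forall fun p =>
    ha.trans_le (capacityError_nonneg p), fun a ha => ?_⟩
  filter_upwards [eventually_delSubCapacity_le (half_pos ha)] with p hp
  refine lt_of_le_of_lt ?_ (half_lt_self ha)
  rw [capacityError]
  split_ifs with h
  · obtain ⟨⟨h1, h2, h3, h4⟩, hH⟩ := h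
    refine max_le (half_pos ha).le ?_
    have := hp h1 h2 h3 h4
    rw [sub_le_comm, le_div_iff₀ hH]
    linarith
  · exact (half_pos ha).le

theorem theorem3 :
    ∃ o : ℝ × ℝ → ℝ, Tendsto o (𝓝 (0, 0)) (𝓝 0) ∧
      ∀ pd ps : ℝ, 0 ≤ pd → pd < 1 → 0 ≤ ps → pd + ps ≤ 1 →
        delSubCapacity pd ps ≤
          1 - (1 - o (pd, ps)) * (entropyBits pd + entropyBits (ps / (1 - pd))) := by
  refine ⟨capacityError, tendsto_capacityError, fun pd ps hd hd1 hs h => ?_⟩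
  have hp0 : 0 ≤ ps / (1 - pd) := div_nonneg hs (by linarith)
  have hp1 : ps / (1 - pd) ≤ 1 := by rw [div_le_one (by linarith)]; linarith
  rcases (add_nonneg (entropyBits_nonneg hd hd1.le) (entropyBits_nonneg hp0 hp1)).eq_or_lt
    with hH | hH
  · rw [← hH, mul_zero, sub_zero]
    exact delSubCapacity_le_one pd ps
  · have e : capacityError (pd, ps) = max 0 (1 - (1 - delSubCapacity pd ps) /
        (entropyBits pd + entropyBits (ps / (1 - pd)))) := if_pos ⟨⟨hd, hd1, hs, h⟩, hH⟩
    have h1 : 1 - capacityError (pd, ps) ≤ (1 - delSubCapacity pd ps) /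
        (entropyBits pd + entropyBits (ps / (1 - pd))) := by
      rw [e, sub_le_comm]
      exact le_max_right _ _
    rw [le_div_iff₀ hH] at h1
    linarith
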